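/- Let $X,Y,Z$ be random variables on a probability space with values in $\mathbb{R}^{d_X},\mathbb{R}^{d_Y},\mathbb{R}^{d_Z}$, and let $1\le p<\infty$. For a Euclidean space $U$ let $\mathcal{P}_p(U)$ be the set of Borel probability measures on $U$ with finite $p$-th moment, and let $$W_p(\mu,\nu)=\inf_{\gamma}\Bigl(\int_{U\times U}\|x-y\|^p\,d\gamma(x,y)\Bigr)^{1/p},$$ the infimum being over all couplings $\gamma$ of $\mu$ and $\nu$; here $U=\mathbb{R}^{d_X}\times\mathbb{R}^{d_Y}=\mathbb{R}^{d_X+d_Y}$ carries the Euclidean norm. Let $z\mapsto\mathcal{L}_{(X,Y)|Z=z}$ be a regular conditional distribution of $(X,Y)$ given $Z$, and suppose that it is $L_{XY}$-Lipschitz with respect to $W_p$ on the support of the law $\mathcal{L}_Z$ of $Z$, that is, $\mathcal{L}_{(X,Y)|Z=z}\in\mathcal{P}_p(U)$ and $$W_p\bigl(\mathcal{L}_{(X,Y)|Z=z},\mathcal{L}_{(X,Y)|Z=z'}\bigr)\le L_{XY}\,|z-z'|\qquad\text{for all } z,z'\in\operatorname{supp}(\mathcal{L}_Z).$$ Let $\varepsilon>0$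 and let $\{V_j\}_{j=1}^J$ be a finite measurable partition of $\operatorname{supp}(\mathcal{L}_Z)$ with $\operatorname{diam}(V_j)\le\varepsilon/L_{XY}$ for every $j$ (no restriction on the diameters if $L_{XY}=0$). Then, for every $j$ with $\mathbb{P}(Z\in V_j)>0$ and every $z_0\in V_j$, the conditional law $\mathcal{L}_{(X,Y)|Z\in V_j}$ of $(X,Y)$ given the event $\{Z\in V_j\}$ belongs to $\mathcal{P}_p(U)$ and $$W_p\bigl(\mathcal{L}_{(X,Y)|Z\in V_j},\mathcal{L}_{(X,Y)|Z=z_0}\bigr)\le\varepsilon .$$ -/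

import Mathlib

open MeasureTheory ProbabilityTheory
open scoped ENNReal NNReal

noncomputable section

/-- Couplings (transport plans) of `μ` and `ν`: measures on `U × U` with marginals `μ` and `ν`. -/
def couplings {U : Type*} [MeasurableSpace U] (μ ν : Measure U) : Set (Measure (U × U)) :=
  {γ | γ.map Prod.fst = μ ∧ γ.map Prod.snd = ν}

/-- The space `𝒫_p(U)` of probability measures on `U` with finite `p`-th moment. -/
def wassersteinSpace (U : Type*) [PseudoEMetricSpace U] [MeasurableSpace U] (p : ℝ) :
    Set (Measure U) :=
  {μ | IsProbabilityMeasure μ ∧ ∃ x₀ : U, ∫⁻ x, edist x x₀ ^ p ∂μ < ∞}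

/-- The `p`-Wasserstein distance, the infimum over couplings `γ` of
`(∫ d(x, y) ^ p dγ(x, y)) ^ (1 / p)`. It takes values in `[0, ∞]` and is finite on `𝒫_p(U)`. -/
def wassersteinDist {U : Type*} [PseudoEMetricSpace U] [MeasurableSpace U] (p : ℝ)
    (μ ν : Measure U) : ℝ≥0∞ :=
  ⨅ γ ∈ couplings μ ν, (∫⁻ x, edist x.1 x.2 ^ p ∂γ) ^ (1 / p)

/-- `κ` is a regular conditional distribution of `T` given `Z` (a version of the family
`z ↦ ℒ_{T | Z = z}`): a probability kernel that disintegrates the joint law of `(Z, T)` over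
the law of `Z`. -/
structure IsRegularCondDistrib {Ω S U : Type*} [MeasurableSpace Ω] [MeasurableSpace S]
    [MeasurableSpace U] (P : Measure Ω) (T : Ω → U) (Z : Ω → S) (κ : Kernel S U) : Prop where
  isMarkovKernel : IsMarkovKernel κ
  disintegration : (P.map Z) ⊗ₘ κ = P.map (fun ω => (Z ω, T ω))

/-- `z ↦ κ z` is `L`-Lipschitz on the set `s`, as a map into `(𝒫_p(U), W_p)`. -/
def IsWassersteinLipschitzOn {S U : Type*} [PseudoEMetricSpace S] [PseudoEMetricSpace U]
    [MeasurableSpace U] (p : ℝ) (L : ℝ≥0) (κ : S → Measure U) (s : Set S) : Prop :=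
  (∀ z ∈ s, κ z ∈ wassersteinSpace U p) ∧
    ∀ z ∈ s, ∀ z' ∈ s, wassersteinDist p (κ z) (κ z') ≤ L * edist z z'

/-- `V` is a finite measurable partition of `s`. -/
structure IsMeasurablePartition {S : Type*} [MeasurableSpace S] {J : ℕ} (V : Fin J → Set S)
    (s : Set S) : Prop where
  measurableSet : ∀ j, MeasurableSet (V j)
  pairwise_disjoint : ∀ i j, i ≠ j → Disjoint (V i) (V j)
  iUnion_eq : ⋃ j, V j = s

/-- The law `ℒ_{T | Z ∈ V}` of `T` under `P` conditioned on the event `{Z ∈ V}`; meaningful when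
`P (Z ∈ V) > 0`. -/
def condLaw {Ω S U : Type*} [MeasurableSpace Ω] [MeasurableSpace U] (P : Measure Ω) (T : Ω → U)
    (Z : Ω → S) (V : Set S) : Measure U :=
  (cond P (Z ⁻¹' V)).map T

/-- `ℝ^m × ℝ^n` with the Euclidean norm `‖(x, y)‖ = √(‖x‖² + ‖y‖²)`. -/
abbrev EuclideanProd (m n : ℕ) : Type :=
  WithLp 2 (EuclideanSpace ℝ (Fin m) × EuclideanSpace ℝ (Fin n))

/-- The joint variable `(X, Y)`. -/
def jointVar {Ω : Type*} {m n : ℕ} (X : Ω → EuclideanSpace ℝ (Fin m))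
    (Y : Ω → EuclideanSpace ℝ (Fin n)) (ω : Ω) : EuclideanProd m n :=
  WithLp.toLp 2 (X ω, Y ω)

end

open Filter Topology

section Couplings

variable {U : Type*} [MeasurableSpace U] {μ ν : Measure U} {γ : Measure (U × U)}

/-! The conditional law given `Z ∈ V j` is the mixture of the `κ z` over the law of `Z` conditioned
on `V j` (`condLaw_eq_bind`), and each `κ z` there is within `ε` of `κ z₀`. Mixing couplings of `κ
z` with `κ z₀` should keep the cost below `ε ^ p`, but this asks for couplings measurable in `z`.
Replacing `z` by simple functions with values in `V j` leaves finitely many couplings to choose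
(`wassersteinDist_bind_simpleFunc_le`). The Lipschitz bound makes these mixtures converge weakly,
and lower semicontinuity (`wassersteinDist_le_of_tendsto`) passes to the limit. -/

theorem isProbabilityMeasure_of_mem_couplings [IsProbabilityMeasure μ] (hγ : γ ∈ couplings μ ν) :
    IsProbabilityMeasure γ := by
  refine ⟨?_⟩
  have h : γ.map Prod.fst Set.univ = 1 := by rw [hγ.1]; exact measure_univ
  rwa [Measure.map_apply measurable_fst MeasurableSet.univ, Set.preimage_univ] at h

/-- Pushforward commutes with mixing, so the marginals of a mixture are the mixtures of the
marginals. -/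
theorem bind_mem_couplings {S : Type*} [MeasurableSpace S] {Q : Measure S} {g : S → Measure (U × U)}
    {m n : S → Measure U} (hg : Measurable g) (hgmn : ∀ z, g z ∈ couplings (m z) (n z)) :
    Q.bind g ∈ couplings (Q.bind m) (Q.bind n) := by
  constructor
  · rw [Measure.bind, ← Measure.join_map_map measurable_fst,
      Measure.map_map (Measure.measurable_map _ measurable_fst) hg]
    exact congrArg (fun f => (Q.map f).join) (funext fun z => (hgmn z).1)
  · rw [Measure.bind, ← Measure.join_map_map measurable_snd,
      Measure.map_map (Measure.measurable_map _ measurable_snd) hg]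
    exact congrArg (fun f => (Q.map f).join) (funext fun z => (hgmn z).2)

end Couplings

section Cost

variable {U : Type*} [PseudoEMetricSpace U] [MeasurableSpace U] {p : ℝ} {μ ν : Measure U}

theorem exists_coupling_lintegral_lt {C : ℝ≥0∞} (hp : 0 < p) (h : wassersteinDist p μ ν < C) :
    ∃ γ ∈ couplings μ ν, ∫⁻ x, edist x.1 x.2 ^ p ∂γ < C ^ p := by
  simp only [wassersteinDist, iInf_lt_iff] at h
  obtain ⟨γ, hγ, h⟩ := h
  refine ⟨γ, hγ, ?_⟩
  rwa [one_div, ENNReal.rpow_inv_lt_iff hp] at h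

theorem wassersteinDist_le_of_coupling {C : ℝ≥0∞} (hp : 0 < p) {γ : Measure (U × U)}
    (hγ : γ ∈ couplings μ ν) (h : ∫⁻ x, edist x.1 x.2 ^ p ∂γ ≤ C ^ p) :
    wassersteinDist p μ ν ≤ C := by
  refine (iInf₂_le γ hγ).trans ?_
  rwa [one_div, ENNReal.rpow_inv_le_iff hp]

theorem mem_wassersteinSpace_of_wassersteinDist_lt_top [OpensMeasurableSpace U] (hp : 1 ≤ p)
    [IsProbabilityMeasure μ]
    (hν : ν ∈ wassersteinSpace U p) (h : wassersteinDist p μ ν < ∞) : μ ∈ wassersteinSpace U p := by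
  have hp0 : 0 < p := one_pos.trans_le hp
  obtain ⟨-, x₀, hx₀⟩ := hν
  obtain ⟨γ, hγ, hlt⟩ := exists_coupling_lintegral_lt hp0 h
  rw [ENNReal.top_rpow_of_pos hp0] at hlt
  refine ⟨inferInstance, x₀, ?_⟩
  have hm : Measurable fun x : U => edist x x₀ ^ p :=
    (measurable_edist_left : Measurable fun x : U => edist x x₀).pow_const p
  rw [← hγ.2, lintegral_map hm measurable_snd] at hx₀
  rw [← hγ.1, lintegral_map hm measurable_fst]
  calc ∫⁻ x, edist x.1 x₀ ^ p ∂γ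
      ≤ ∫⁻ x, 2 ^ (p - 1) * (edist x.1 x.2 ^ p + edist x.2 x₀ ^ p) ∂γ := by
        refine lintegral_mono fun x => ?_
        refine (ENNReal.rpow_le_rpow (edist_triangle x.1 x.2 x₀) hp0.le).trans ?_
        exact ENNReal.rpow_add_le_mul_rpow_add_rpow _ _ hp
    _ = 2 ^ (p - 1) * (∫⁻ x, edist x.1 x.2 ^ p ∂γ + ∫⁻ x, edist x.2 x₀ ^ p ∂γ) := by
        rw [lintegral_const_mul', lintegral_add_right _ (show Measurable fun x : U × U => edist x.2 x₀ ^ p from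
          hm.comp measurable_snd)]
        exact ENNReal.rpow_ne_top_of_nonneg (by linarith) (by simp)
    _ < ∞ := ENNReal.mul_lt_top (ENNReal.rpow_lt_top_of_nonneg (by linarith) (by simp))
        (ENNReal.add_lt_top.2 ⟨hlt, hx₀⟩)

variable [SecondCountableTopology U] [BorelSpace U]

/-- The easy half of Kantorovich–Rubinstein duality, with `W_1 ≤ W_p`. Boundedness of `f` serves
only integrability. -/
theorem enorm_integral_sub_le_wassersteinDist (hp : 1 ≤ p) [IsProbabilityMeasure μ]
    [IsProbabilityMeasure ν] {f : U → ℝ} {K : ℝ≥0} (hf : LipschitzWith K f)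
    {C : ℝ} (hC : ∀ x y, dist (f x) (f y) ≤ C) (hW : wassersteinDist p μ ν ≠ ∞) :
    ‖∫ x, f x ∂μ - ∫ x, f x ∂ν‖ₑ ≤ K * wassersteinDist p μ ν := by
  have hint : ∀ (m : Measure U) [IsProbabilityMeasure m], Integrable f m := by
    intro m _
    obtain ⟨x₀⟩ : Nonempty U := m.nonempty_of_neZero
    refine Integrable.of_bound hf.continuous.aestronglyMeasurable (C + ‖f x₀‖) (.of_forall fun x => ?_)
    have h1 := hC x x₀
    rw [dist_eq_norm] at h1
    have h2 := norm_sub_norm_le (f x) (f x₀)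
    linarith
  refine ENNReal.le_mul_of_forall_lt (.inr hW) (.inl ENNReal.coe_ne_top) fun K' hK' C' hC' => ?_
  obtain ⟨γ, hγ, hlt⟩ := exists_coupling_lintegral_lt (one_pos.trans_le hp) hC'
  have := isProbabilityMeasure_of_mem_couplings hγ
  have h1 : Integrable (fun x : U × U => f x.1) γ :=
    Integrable.comp_measurable (by rw [hγ.1]; exact hint μ) measurable_fst
  have h2 : Integrable (fun x : U × U => f x.2) γ :=
    Integrable.comp_measurable (by rw [hγ.2]; exact hint ν) measurable_snd
  have e1 : ∫ x, f x ∂μ = ∫ x, f x.1 ∂γ := by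
    rw [← hγ.1, integral_map measurable_fst.aemeasurable hf.continuous.aestronglyMeasurable]
  have e2 : ∫ x, f x ∂ν = ∫ x, f x.2 ∂γ := by
    rw [← hγ.2, integral_map measurable_snd.aemeasurable hf.continuous.aestronglyMeasurable]
  rw [e1, e2, ← integral_sub h1 h2]
  calc ‖∫ x, (f x.1 - f x.2) ∂γ‖ₑ ≤ ∫⁻ x, ‖f x.1 - f x.2‖ₑ ∂γ :=
        enorm_integral_le_lintegral_enorm _
    _ ≤ ∫⁻ x, K * edist x.1 x.2 ∂γ :=
        lintegral_mono fun x => by rw [← edist_eq_enorm_sub]; exact hf x.1 x.2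
    _ = K * ∫⁻ x, edist x.1 x.2 ∂γ := lintegral_const_mul' _ _ ENNReal.coe_ne_top
    -- Monotonicity of `L^p` norms, as `γ` has mass one.
    _ ≤ K * (∫⁻ x, edist x.1 x.2 ^ p ∂γ) ^ (1 / p) := by
        gcongr
        simpa [eLpNorm'] using eLpNorm'_le_eLpNorm'_of_exponent_le one_pos hp γ
          (measurable_edist (α := U)).aestronglyMeasurable
    _ ≤ K' * C' := by
        gcongr
        rw [one_div, ENNReal.rpow_inv_le_iff (one_pos.trans_le hp)]
        exact hlt.le

end Cost

section WeakConvergence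

variable {U : Type*} [MetricSpace U] [SecondCountableTopology U] [MeasurableSpace U] [BorelSpace U]
  {p : ℝ}

theorem tendsto_of_tendsto_wassersteinDist (hp : 1 ≤ p) {μs : ℕ → ProbabilityMeasure U}
    {μ : ProbabilityMeasure U}
    (h : Tendsto (fun n => wassersteinDist p (μs n : Measure U) (μ : Measure U)) atTop (𝓝 0)) :
    Tendsto μs atTop (𝓝 μ) := by
  rw [tendsto_iff_forall_lipschitz_integral_tendsto]
  rintro f ⟨C, hC⟩ ⟨K, hf⟩
  rw [tendsto_iff_edist_tendsto_0]
  have hK : Tendsto (fun n => K * wassersteinDist p (μs n : Measure U) (μ : Measure U)) atTop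
      (𝓝 0) := by
    simpa using ENNReal.Tendsto.const_mul h (Or.inr (ENNReal.coe_ne_top (r := K)))
  refine tendsto_of_tendsto_of_tendsto_of_le_of_le' tendsto_const_nhds hK
    (.of_forall fun _ => zero_le) ?_
  filter_upwards [h.eventually_lt_const ENNReal.zero_lt_top] with n hn
  rw [edist_eq_enorm_sub]
  exact enorm_integral_sub_le_wassersteinDist hp hf hC hn.ne

/-- The transport cost is lower semicontinuous under weak convergence. -/
theorem lintegral_edist_rpow_le_of_tendsto (hp : 0 ≤ p) {γs : ℕ → ProbabilityMeasure (U × U)}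
    {γ : ProbabilityMeasure (U × U)} (hγ : Tendsto γs atTop (𝓝 γ)) {C : ℝ≥0∞}
    (hC : ∀ n, ∫⁻ x, edist x.1 x.2 ^ p ∂(γs n : Measure (U × U)) ≤ C) :
    ∫⁻ x, edist x.1 x.2 ^ p ∂(γ : Measure (U × U)) ≤ C := by
  have hcost : ∀ x : U × U, edist x.1 x.2 ^ p = ENNReal.ofReal (dist x.1 x.2 ^ p) := fun x => by
    rw [edist_dist, ENNReal.ofReal_rpow_of_nonneg dist_nonneg hp]
  simp only [hcost] at hC ⊢
  have hcont : Continuous fun x : U × U => dist x.1 x.2 ^ p :=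
    continuous_dist.rpow_const fun _ => Or.inr hp
  refine (lintegral_le_liminf_lintegral_of_forall_isOpen_measure_le_liminf_measure hcont
    (fun x => Real.rpow_nonneg dist_nonneg p)
    fun G hG => ProbabilityMeasure.le_liminf_measure_open_of_tendsto hγ hG).trans ?_
  exact liminf_le_of_le (by isBoundedDefault) fun b hb => by
    obtain ⟨n, hn⟩ := hb.exists
    exact hn.trans (hC n)

variable [CompleteSpace U]

/-- A convergent sequence together with its limit is compact, and the converse half of Prokhorov's
theorem applies. -/
theorem isTightMeasureSet_range_of_tendsto {μs : ℕ → ProbabilityMeasure U}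
    {μ : ProbabilityMeasure U} (h : Tendsto μs atTop (𝓝 μ)) :
    IsTightMeasureSet (Set.range fun n => (μs n : Measure U)) := by
  have hK := h.isCompact_insert_range
  refine (isTightMeasureSet_of_isCompact_closure (by rwa [hK.isClosed.closure_eq])).subset ?_
  rintro _ ⟨n, rfl⟩
  exact ⟨μs n, Or.inr ⟨n, rfl⟩, rfl⟩

/-- The Wasserstein distance is lower semicontinuous under weak convergence. -/
theorem wassersteinDist_le_of_tendsto (hp : 0 < p) {μs νs : ℕ → ProbabilityMeasure U}
    {μ ν : ProbabilityMeasure U} (hμ : Tendsto μs atTop (𝓝 μ)) (hν : Tendsto νs atTop (𝓝 ν))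
    {C : ℝ≥0∞} (hC : ∀ n, wassersteinDist p (μs n : Measure U) (νs n : Measure U) ≤ C) :
    wassersteinDist p (μ : Measure U) (ν : Measure U) ≤ C := by
  refine le_of_forall_gt_imp_ge_of_dense fun C' hC' => ?_
  choose γ hγ hlt using fun n => exists_coupling_lintegral_lt hp ((hC n).trans_lt hC')
  let γs : ℕ → ProbabilityMeasure (U × U) := fun n =>
    ⟨γ n, isProbabilityMeasure_of_mem_couplings (hγ n)⟩
  -- Tight marginals force tight couplings, so Prokhorov yields a limit plan.
  have htight : IsTightMeasureSet {m : Measure (U × U) |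
      ∃ m' ∈ Set.range γs, (m' : Measure (U × U)) = m} := by
    refine IsTightMeasureSet.prodMk ((isTightMeasureSet_range_of_tendsto hμ).subset ?_)
      ((isTightMeasureSet_range_of_tendsto hν).subset ?_)
    · rintro _ ⟨_, ⟨_, ⟨n, rfl⟩, rfl⟩, rfl⟩
      exact ⟨n, (hγ n).1.symm⟩
    · rintro _ ⟨_, ⟨_, ⟨n, rfl⟩, rfl⟩, rfl⟩
      exact ⟨n, (hγ n).2.symm⟩
  obtain ⟨γ₀, -, φ, hφ, hlim⟩ := (isCompact_closure_of_isTightMeasureSet htight).tendsto_subseq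
    fun n => subset_closure (Set.mem_range_self n)
  have hcoup : (γ₀ : Measure (U × U)) ∈ couplings (μ : Measure U) (ν : Measure U) := by
    constructor
    · refine congrArg ProbabilityMeasure.toMeasure (tendsto_nhds_unique
        (ProbabilityMeasure.tendsto_map_of_tendsto_of_continuous _ _ hlim continuous_fst)
        ((hμ.comp hφ.tendsto_atTop).congr fun n => Subtype.ext ?_))
      exact (hγ (φ n)).1.symm
    · refine congrArg ProbabilityMeasure.toMeasure (tendsto_nhds_unique
        (ProbabilityMeasure.tendsto_map_of_tendsto_of_continuous _ _ hlim continuous_snd)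
        ((hν.comp hφ.tendsto_atTop).congr fun n => Subtype.ext ?_))
      exact (hγ (φ n)).2.symm
  exact wassersteinDist_le_of_coupling hp hcoup
    (lintegral_edist_rpow_le_of_tendsto hp.le hlim fun n => (hlt (φ n)).le)

end WeakConvergence

section Mixture

/-- Averaging over a measure with finitely many atoms does not increase the Wasserstein distance
to a fixed measure. -/
theorem wassersteinDist_bind_simpleFunc_le {S U : Type*} [MeasurableSpace S] [PseudoEMetricSpace U]
    [SecondCountableTopology U] [MeasurableSpace U] [BorelSpace U] {p : ℝ} (hp : 0 < p)
    {Q : Measure S} [IsProbabilityMeasure Q] {ν : Measure U} {C : ℝ≥0∞}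
    (φ : SimpleFunc S S) (κ : S → Measure U) (hC : ∀ z, wassersteinDist p (κ (φ z)) ν ≤ C) :
    wassersteinDist p (Q.bind fun z => κ (φ z)) ν ≤ C := by
  refine le_of_forall_gt_imp_ge_of_dense fun C' hC' => ?_
  have hex : ∀ z, ∃ γ : Measure (U × U), z ∈ Set.range φ →
      γ ∈ couplings (κ z) ν ∧ ∫⁻ x, edist x.1 x.2 ^ p ∂γ < C' ^ p := by
    intro z
    by_cases hz : z ∈ Set.range φ
    · obtain ⟨w, rfl⟩ := hz
      obtain ⟨γ, h⟩ := exists_coupling_lintegral_lt hp ((hC w).trans_lt hC')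
      exact ⟨γ, fun _ => h⟩
    · exact ⟨0, fun h => (hz h).elim⟩
  choose γ hγ using hex
  -- Any choice `γ` becomes measurable after a simple function, so no selection theorem is needed.
  have hmeas : Measurable fun z => γ (φ z) := (φ.map γ).measurable
  have hcoup := bind_mem_couplings (Q := Q) hmeas fun z => (hγ (φ z) ⟨z, rfl⟩).1
  rw [Measure.bind_const, measure_univ, one_smul] at hcoup
  refine wassersteinDist_le_of_coupling hp hcoup ?_
  rw [Measure.lintegral_bind hmeas.aemeasurable (measurable_edist.pow_const p).aemeasurable]
  refine (lintegral_mono fun z => (hγ (φ z) ⟨z, rfl⟩).2.le).trans ?_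
  simp

/-- Averaging a `W_p`-continuous family of measures does not increase the Wasserstein distance to a
fixed measure. -/
theorem wassersteinDist_bind_le {S U : Type*} [PseudoEMetricSpace S] [SecondCountableTopology S]
    [MeasurableSpace S] [BorelSpace S] [MetricSpace U] [CompleteSpace U]
    [SecondCountableTopology U] [MeasurableSpace U] [BorelSpace U] {p : ℝ} (hp : 1 ≤ p)
    {Q : Measure S} [IsProbabilityMeasure Q] {κ : Kernel S U} [IsMarkovKernel κ] {s : Set S}
    (hs : ∀ᵐ z ∂Q, z ∈ s) {L : ℝ≥0}
    (hκ : ∀ z ∈ s, ∀ z' ∈ s, wassersteinDist p (κ z) (κ z') ≤ L * edist z z')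
    {ν : Measure U} [IsProbabilityMeasure ν] {C : ℝ≥0∞}
    (hC : ∀ z ∈ s, wassersteinDist p (κ z) ν ≤ C) : wassersteinDist p (Q.bind κ) ν ≤ C := by
  obtain ⟨z₀, hz₀⟩ : s.Nonempty := hs.exists
  let φ : ℕ → SimpleFunc S S := SimpleFunc.approxOn id measurable_id s z₀ hz₀
  have hφs : ∀ n z, φ n z ∈ s := fun n z => SimpleFunc.approxOn_mem measurable_id hz₀ n z
  have hmeas : ∀ n, Measurable fun z => κ (φ n z) := fun n =>
    κ.measurable.comp (φ n).measurable
  have hprob : ∀ n, IsProbabilityMeasure (Q.bind fun z => κ (φ n z)) := fun n =>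
    isProbabilityMeasure_bind (hmeas n).aemeasurable (.of_forall fun z => inferInstance)
  let ρs : ℕ → ProbabilityMeasure U := fun n => ⟨Q.bind fun z => κ (φ n z), hprob n⟩
  let ρ : ProbabilityMeasure U := ⟨Q.bind κ, inferInstance⟩
  have hlim : Tendsto ρs atTop (𝓝 ρ) := by
    -- Portmanteau on open sets: the pointwise weak limit `κ (φ n z) → κ z` is integrated by Fatou.
    refine tendsto_of_forall_isOpen_le_liminf' fun G hG => ?_
    change Q.bind κ G ≤ liminf (fun n => Q.bind (fun z => κ (φ n z)) G) atTop
    simp only [Measure.bind_apply hG.measurableSet (hmeas _).aemeasurable,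
      Measure.bind_apply hG.measurableSet κ.measurable.aemeasurable]
    refine le_trans (lintegral_mono_ae ?_)
      (lintegral_liminf_le fun n => (κ.measurable_coe hG.measurableSet).comp (φ n).measurable)
    filter_upwards [hs] with z hz
    refine ProbabilityMeasure.le_liminf_measure_open_of_tendsto
      (μ := ⟨κ z, inferInstance⟩) (μs := fun n => ⟨κ (φ n z), inferInstance⟩)
      (tendsto_of_tendsto_wassersteinDist hp ?_) hG
    have hφ : Tendsto (fun n => φ n z) atTop (𝓝 z) :=
      SimpleFunc.tendsto_approxOn measurable_id hz₀ (subset_closure hz)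
    have hLφ : Tendsto (fun n => L * edist (φ n z) z) atTop (𝓝 0) := by
      simpa using ENNReal.Tendsto.const_mul (tendsto_iff_edist_tendsto_0.1 hφ)
        (Or.inr (ENNReal.coe_ne_top (r := L)))
    exact tendsto_of_tendsto_of_tendsto_of_le_of_le tendsto_const_nhds hLφ (fun _ => zero_le)
      fun n => hκ _ (hφs n z) _ hz
  exact wassersteinDist_le_of_tendsto (one_pos.trans_le hp) hlim
    (tendsto_const_nhds (x := (show ProbabilityMeasure U from ⟨ν, inferInstance⟩)))
    fun n => wassersteinDist_bind_simpleFunc_le (one_pos.trans_le hp) (φ n) κ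
      fun z => hC _ (hφs n z)

end Mixture

/-- The law of `T` conditioned on `{Z ∈ V}` is the average of the regular conditional distribution
over the law of `Z` conditioned on `V`. -/
theorem condLaw_eq_bind {Ω S U : Type*} [MeasurableSpace Ω] [MeasurableSpace S]
    [MeasurableSpace U] {P : Measure Ω} [IsFiniteMeasure P] {T : Ω → U} {Z : Ω → S}
    {κ : Kernel S U} (hκ : IsRegularCondDistrib P T Z κ) (hT : Measurable T) (hZ : Measurable Z)
    {V : Set S} (hV : MeasurableSet V) :
    condLaw P T Z V = (cond (P.map Z) V).bind κ := by
  have := hκ.isMarkovKernel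
  ext B hB
  have h := congrArg (fun m => m (V ×ˢ B)) hκ.disintegration
  simp only [Measure.compProd_apply_prod hV hB,
    Measure.map_apply (hZ.prodMk hT) (hV.prod hB)] at h
  rw [condLaw, Measure.map_apply hT hB, cond_apply (hZ hV), Measure.bind_apply hB
    κ.measurable.aemeasurable, ProbabilityTheory.cond, lintegral_smul_measure, h,
    Measure.map_apply hZ hV]
  rfl

theorem mainTheorem3 {Ω : Type*} [MeasurableSpace Ω] (P : Measure Ω) [IsProbabilityMeasure P]
    (dX dY dZ : ℕ)
    (X : Ω → EuclideanSpace ℝ (Fin dX)) (Y : Ω → EuclideanSpace ℝ (Fin dY))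
    (Z : Ω → EuclideanSpace ℝ (Fin dZ))
    (hX : Measurable X) (hY : Measurable Y) (hZ : Measurable Z)
    (p : ℝ) (hp : 1 ≤ p)
    (κ : Kernel (EuclideanSpace ℝ (Fin dZ)) (EuclideanProd dX dY))
    (hκ : IsRegularCondDistrib P (jointVar X Y) Z κ)
    (L ε : ℝ≥0)
    (hLip : IsWassersteinLipschitzOn p L κ (P.map Z).support)
    (J : ℕ) (V : Fin J → Set (EuclideanSpace ℝ (Fin dZ)))
    (hV : IsMeasurablePartition V (P.map Z).support)
    (hdiam : ∀ j, Metric.ediam (V j) ≤ (ε : ℝ≥0∞) / L) :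
    ∀ j, 0 < P (Z ⁻¹' V j) → ∀ z₀ ∈ V j,
      condLaw P (jointVar X Y) Z (V j) ∈ wassersteinSpace (EuclideanProd dX dY) p ∧
        wassersteinDist p (condLaw P (jointVar X Y) Z (V j)) (κ z₀) ≤ ε := by
  intro j hj z₀ hz₀
  have := hκ.isMarkovKernel
  have hT : Measurable (jointVar X Y) := (WithLp.measurable_toLp 2 _).comp (hX.prodMk hY)
  have hVj := hV.measurableSet j
  have hsub : V j ⊆ (P.map Z).support := hV.iUnion_eq ▸ Set.subset_iUnion V j
  have : IsProbabilityMeasure (P.map Z) := Measure.isProbabilityMeasure_map hZ.aemeasurable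
  have : IsProbabilityMeasure (cond (P.map Z) (V j)) :=
    cond_isProbabilityMeasure (by rw [Measure.map_apply hZ hVj]; exact hj.ne')
  have hdist : wassersteinDist p ((cond (P.map Z) (V j)).bind κ) (κ z₀) ≤ ε := by
    refine wassersteinDist_bind_le hp (ae_cond_mem hVj)
      (fun z hz z' hz' => hLip.2 z (hsub hz) z' (hsub hz')) fun z hz => ?_
    calc wassersteinDist p (κ z) (κ z₀) ≤ L * edist z z₀ := hLip.2 z (hsub hz) z₀ (hsub hz₀)
      -- If `L = 0 < ε`, then `ε / L = ∞` leaves the diameter free, and `0 * ∞ = 0` keeps the bound.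
      _ ≤ L * (ε / L) := by
          gcongr
          exact (Metric.edist_le_ediam_of_mem hz hz₀).trans (hdiam j)
      _ ≤ ε := ENNReal.mul_div_le
  rw [condLaw_eq_bind hκ hT hZ hVj]
  exact ⟨mem_wassersteinSpace_of_wassersteinDist_lt_top hp (hLip.1 z₀ (hsub hz₀))
    (hdist.trans_lt ENNReal.coe_lt_top), hdist⟩
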